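/- Let $\mathbb F_q$ be a finite field, let $K_1,\dots,K_n\subseteq\mathbb F_q$ be non-empty subsets with $d_i:=|K_i|$ and $d_1\le d_2\le\cdots\le d_n$, let $\mathcal X:=K_1\times\cdots\times K_n$ and $m:=|\mathcal X|=\prod_{i=1}^n d_i$, and let $\Psi:\mathbb F_q[X_1,\dots,X_n]\to\mathbb F_q^m$ be the map that evaluates a polynomial at the $m$ points of $\mathcal X$. Let $s\in\{1,\dots,n\}$, let $\delta$ be an integer with $2\le\delta\le d_s$, and put $r:=d_s-\delta+1$. For an integer $d\ge 0$ let $\mathcal C_{\mathcal X}(d)$ (the affine cartesian code) be the image under $\Psi$ of the space of polynomials of total degree at most $d$, and let $\mathcal D^{(\delta,s)}_{\mathcal X}(d)$ (the quasi affine cartesian code) be the image under $\Psi$ of the space consisting of $0$ and all polynomials $f$ of total degree at most $d$ with $\deg_{X_s}f<d_s-\delta+1$. Write $W^{(1)}(C)$ for the minimum (Hamming) distance of a code $C$. Let $d=\sum_{i=1}^k(d_i-1)+\ell$ with integers $0\le k<n$ and $0<\ell\le d_{k+1}-1$, and let $\kappa:=\dim_{\mathbb F_q}\mathcal D^{(\delta,s)}_{\mathcal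 X}(d)$. Then $$W^{(1)}(\mathcal C_{\mathcal X}(d))\;\le\;W^{(1)}(\mathcal D^{(\delta,s)}_{\mathcal X}(d))\;\le\;m-\kappa-\left(\left\lceil\frac{\kappa}{r}\right\rceil-1\right)(\delta-1)+1 .$$ Moreover, if (i) $k+2\le n$ and $d_{k+2}\le d_s$, or (ii) $d_s\le d_{k+1}$ and $0\le d_s-(d_{k+1}-\ell)<r$, then $W^{(1)}(\mathcal D^{(\delta,s)}_{\mathcal X}(d))=W^{(1)}(\mathcal C_{\mathcal X}(d))$. -/

import Mathlib

/-- The minimum (Hamming) distance of a linear code: the least Hamming distance between two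
distinct codewords. (For the zero code there are no such pairs and the value is `0` by
convention.) -/
noncomputable def minDistance {F ι : Type*} [Field F] [DecidableEq F] [Fintype ι]
    (C : Submodule F (ι → F)) : ℕ :=
  sInf {w : ℕ | ∃ x ∈ C, ∃ y ∈ C, x ≠ y ∧ hammingDist x y = w}

/-- Evaluation of polynomials at all the points of `K₁ × ⋯ × Kₙ`; the coordinates of the target
are indexed by the points themselves. -/
noncomputable def evalPoints {F : Type*} [Field F] {n : ℕ} (K : Fin n → Finset F) :
    MvPolynomial (Fin n) F →ₗ[F] (↥(Fintype.piFinset K) → F) :=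
  LinearMap.pi fun α => (MvPolynomial.aeval (α : Fin n → F)).toLinearMap

/-- The affine cartesian code of order `d`: the image under evaluation of all polynomials of
total degree at most `d`. -/
noncomputable def affineCartesianCode {F : Type*} [Field F] {n : ℕ} (K : Fin n → Finset F)
    (d : ℕ) : Submodule F (↥(Fintype.piFinset K) → F) :=
  (MvPolynomial.restrictTotalDegree (Fin n) F d).map (evalPoints K)

/-- The space of polynomials `f` of total degree at most `d` with
`deg_{X_s} f < |K_s| - δ + 1`, together with the zero polynomial. -/
noncomputable def quasiPolynomials {F : Type*} [Field F] {n : ℕ} (K : Fin n → Finset F)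
    (δ : ℕ) (s : Fin n) (d : ℕ) : Submodule F (MvPolynomial (Fin n) F) where
  carrier := {f | f.totalDegree ≤ d ∧
    (f = 0 ∨ (f.degreeOf s : ℤ) < ((K s).card : ℤ) - (δ : ℤ) + 1)}
  zero_mem' := ⟨by simp, Or.inl rfl⟩
  add_mem' := by
    rintro f g ⟨hf, hf'⟩ ⟨hg, hg'⟩
    refine ⟨(MvPolynomial.totalDegree_add f g).trans (max_le hf hg), ?_⟩
    rcases hf' with rfl | hf'
    · simpa using hg'
    rcases hg' with rfl | hg'
    · simpa using Or.inr hf'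
    right
    have h := MvPolynomial.degreeOf_add_le s f g
    rcases le_max_iff.1 h with h | h <;> omega
  smul_mem' := by
    rintro c f ⟨hf, hf'⟩
    refine ⟨(MvPolynomial.totalDegree_smul_le c f).trans hf, ?_⟩
    rcases hf' with rfl | hf'
    · left; simp
    right
    have h : (c • f).degreeOf s ≤ f.degreeOf s := by
      rw [MvPolynomial.smul_eq_C_mul]
      exact MvPolynomial.degreeOf_C_mul_le f s c
    omega

/-- The `(δ, s)`-quasi affine cartesian code of order `d`. -/
noncomputable def quasiAffineCartesianCode {F : Type*} [Field F] {n : ℕ} (K : Fin n → Finset F)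
    (δ : ℕ) (s : Fin n) (d : ℕ) : Submodule F (↥(Fintype.piFinset K) → F) :=
  (quasiPolynomials K δ s d).map (evalPoints K)

/-! The first inequality is inclusion of codes. For the second, a word of the quasi affine cartesian
code restricted to a line in direction `s` is a polynomial of degree less than `r`, so `r` zeros on
such a line force zeros on all its `d_s = r + (δ - 1)` points. Spending `κ - 1` linear conditions on
`r` points of each of `⌊(κ - 1) / r⌋` lines, and the rest on one further line, leaves a nonzero word
with `δ - 1` additional zeros per completed line (`exists_hammingNorm_add_le_card`).

For the equality, both distances are squeezed against the product of `greedyWeights`. Below: a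
reduced polynomial has at least `∏ x i` nonzeros, where the deficits `d_i - x i` add up to at most
its degree, and an exchange argument shows that this product is least when the smallest sides are
exhausted first (`prod_greedyWeights_le_hammingNorm`). Above: a product of linear factors attains
the bound, and conditions (i) and (ii) allow the weights to be permuted so that its degree in `X_s`
stays below `r` (`minDistance_quasiAffineCartesianCode_le`). -/

/-! ### Nonzeros of polynomials on a grid. -/

open Finset MvPolynomial in
/-- A nonzero polynomial whose degree in each variable is less than the size of the corresponding
side of a grid has at least `∏ x i` nonzeros on the grid, where `∑ (#(K i) - x i)` is at most its
total degree. -/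
theorem exists_prod_le_card_eval_ne_zero_of_degreeOf_lt {F : Type*} [Field F] [DecidableEq F] :
    ∀ {n : ℕ} (K : Fin n → Finset F) (f : MvPolynomial (Fin n) F), f ≠ 0 →
      (∀ i, f.degreeOf i < #(K i)) →
      ∃ x : Fin n → ℕ, (∀ i, 1 ≤ x i ∧ x i ≤ #(K i)) ∧
        ∑ i, #(K i) ≤ ∑ i, x i + f.totalDegree ∧
        ∏ i, x i ≤ #{a ∈ Fintype.piFinset K | eval a f ≠ 0}
  | 0, K, f, hf, _ => by
    refine ⟨fun _ => 1, fun i => i.elim0, by simp, ?_⟩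
    rw [f.eq_C_of_isEmpty] at hf ⊢
    have : coeff 0 f ≠ 0 := fun h => hf (by rw [h, C_0])
    simp [this]
  | n + 1, K, f, hf, hdeg => by
    set p := finSuccEquiv F n f with hp
    set k := p.natDegree with hk
    have hp0 : p ≠ 0 := EmbeddingLike.map_ne_zero_iff.2 hf
    have hg0 : p.coeff k ≠ 0 := by
      rw [hk, Polynomial.coeff_natDegree]; exact Polynomial.leadingCoeff_ne_zero.2 hp0
    have hkd : k < #(K 0) := by
      rw [hk, hp, natDegree_finSuccEquiv]; exact hdeg 0
    obtain ⟨x, hx, hsum, hprod⟩ := exists_prod_le_card_eval_ne_zero_of_degreeOf_lt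
      (fun i => K i.succ) (p.coeff k) hg0
      (fun i => (degreeOf_coeff_finSuccEquiv f i k).trans_lt (hdeg i.succ))
    -- Where the leading coefficient in `X 0` is nonzero, the restriction of `f` to the line in
    -- direction `0` is a nonzero polynomial of degree at most `k`, hence has at least `#(K 0) - k`
    -- nonzeros on `K 0`.
    refine ⟨Fin.cons (#(K 0) - k) x, ?_, ?_, ?_⟩
    · intro i
      refine Fin.cases ?_ (fun i => ?_) i
      · simp only [Fin.cons_zero]; omega
      · simpa using hx i
    · have h := totalDegree_coeff_finSuccEquiv_add_le f k hg0
      rw [← hp] at h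
      rw [Fin.sum_univ_succ, Fin.sum_univ_succ]
      simp only [Fin.cons_zero, Fin.cons_succ]
      omega
    · rw [Fin.prod_univ_succ]
      simp only [Fin.cons_zero, Fin.cons_succ]
      set T := {a ∈ Fintype.piFinset (fun i : Fin n => K i.succ) | eval a (p.coeff k) ≠ 0} with hT
      calc (#(K 0) - k) * ∏ i, x i ≤ (#(K 0) - k) * #T := Nat.mul_le_mul_left _ hprod
        _ = ∑ _a ∈ T, (#(K 0) - k) := by rw [sum_const, smul_eq_mul, mul_comm]
        _ ≤ ∑ a ∈ T, #{c ∈ K 0 | eval (Fin.cons c a : Fin (n + 1) → F) f ≠ 0} := by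
          refine sum_le_sum fun a ha => ?_
          have ha' := (mem_filter.1 ha).2
          set q := p.map (eval a) with hq
          have hq0 : q ≠ 0 := fun h => ha' <| by
            rw [← Polynomial.coeff_map, ← hq, h, Polynomial.coeff_zero]
          have hroots : #{c ∈ K 0 | eval (Fin.cons c a : Fin (n + 1) → F) f = 0} ≤ k := by
            calc _ ≤ #q.roots.toFinset := by
                  gcongr
                  intro c hc
                  simp only [mem_filter, eval_eq_eval_mv_eval'] at hc
                  simp [hq0, q, p, hc.2]
              _ ≤ Multiset.card q.roots := q.roots.toFinset_card_le
              _ ≤ q.natDegree := q.card_roots'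
              _ ≤ k := Polynomial.natDegree_map_le
          have := card_filter_add_card_filter_not (s := K 0)
            (fun c => eval (Fin.cons c a : Fin (n + 1) → F) f = 0)
          simp only [ne_eq]
          omega
        _ = #(T.sigma fun a => {c ∈ K 0 | eval (Fin.cons c a : Fin (n + 1) → F) f ≠ 0}) :=
          (card_sigma _ _).symm
        _ ≤ _ := by
          refine card_le_card_of_injOn
            (fun z : (_ : Fin n → F) × F => (Fin.cons z.2 z.1 : Fin (n + 1) → F)) ?_ ?_
          · rintro ⟨a, c⟩ h
            simp only [coe_sigma, Set.mem_sigma_iff, mem_coe, mem_filter, hT,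
              Fintype.mem_piFinset] at h
            simp only [coe_filter, Set.mem_ofPred_eq, Fintype.mem_piFinset]
            refine ⟨fun i => ?_, h.2.2⟩
            refine Fin.cases ?_ (fun i => ?_) i
            · simpa using h.2.1
            · simpa using h.1.1 i
          · rintro ⟨a, c⟩ _ ⟨a', c'⟩ _ h
            have := Fin.cons_inj.1 h
            obtain ⟨rfl, rfl⟩ := this
            rfl

open Finset MvPolynomial MonomialOrder in
/-- On a grid, every polynomial agrees with one of no larger total degree whose degree in each
variable is less than the size of the corresponding side. -/
theorem exists_degreeOf_lt_card_eval_eq {F : Type*} [Field F] {n : ℕ}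
    (K : Fin n → Finset F) (hK : ∀ i, (K i).Nonempty) (f : MvPolynomial (Fin n) F) :
    ∃ g : MvPolynomial (Fin n) F, g.totalDegree ≤ f.totalDegree ∧
      (∀ i, g.degreeOf i < #(K i)) ∧ ∀ a, (∀ i, a i ∈ K i) → eval a g = eval a f := by
  have hmonic (i : Fin n) : degLex.Monic (∏ c ∈ K i, (X i - C c : MvPolynomial (Fin n) F)) :=
    Monic.prod fun c _ => degLex.monic_X_sub_C i c
  have hdegree (i : Fin n) :
      degLex.degree (∏ c ∈ K i, (X i - C c : MvPolynomial (Fin n) F)) =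
        Finsupp.single i #(K i) := by
    rw [degree_prod_of_regular]
    · simp [Finset.sum_congr rfl fun r _ => degLex.degree_X_sub_C i r]
    · intro c _
      rw [degLex.monic_X_sub_C]
      exact isRegular_one
  -- The divisors vanish on the grid, so the remainder has the same values there. A graded order is
  -- needed for the subtracted multiples not to exceed the total degree of `f`.
  obtain ⟨h, g, hf, hh, hg⟩ := degLex.div
    (b := fun i => ∏ c ∈ K i, (X i - C c : MvPolynomial (Fin n) F))
    (fun i => by rw [(hmonic i).leadingCoeff_eq_one]; exact isUnit_one) f
  have hsum : Finsupp.linearCombination (MvPolynomial (Fin n) F)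
      (fun i => ∏ c ∈ K i, (X i - C c : MvPolynomial (Fin n) F)) h =
        ∑ i, h i * ∏ c ∈ K i, (X i - C c : MvPolynomial (Fin n) F) := by
    rw [Finsupp.linearCombination_apply, Finsupp.sum_fintype _ _ (by simp)]
    simp
  rw [hsum] at hf
  refine ⟨g, ?_, fun i => ?_, fun a ha => ?_⟩
  · rw [← sub_eq_iff_eq_add'] at hf
    rw [← hf]
    refine (totalDegree_sub _ _).trans (max_le le_rfl ?_)
    refine totalDegree_finsetSum_le fun i _ => ?_
    rw [mul_comm]
    exact degLex_totalDegree_monotone (hh i)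
  · rw [degreeOf_eq_sup, Finset.sup_lt_iff (by simp [hK i])]
    intro c hc
    have := hg c hc i
    rw [hdegree] at this
    by_contra hcon
    exact this (Finsupp.single_le_iff.2 (not_lt.1 hcon))
  · rw [hf, map_add, map_sum, Finset.sum_eq_zero, zero_add]
    intro i _
    rw [map_mul, map_prod, Finset.prod_eq_zero (ha i) (by simp), mul_zero]

/-! ### Minimising a product under a lower bound on the sum. -/

open Finset in
/-- Under a lower bound on the sum of the `x i ∈ [1, d i]`, with `d` nondecreasing, the product of
the `x i` is least when the deficits `d i - x i` are concentrated on the smallest indices. -/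
theorem mul_prod_Ico_le_prod_Ico {d x : ℕ → ℕ} {n : ℕ}
    (hd : ∀ i j, i ≤ j → j < n → d i ≤ d j) (hx : ∀ i < n, 1 ≤ x i ∧ x i ≤ d i) :
    ∀ (N a k v : ℕ), n - a = N → a ≤ k → k < n → 1 ≤ v → v ≤ d k →
      (k - a) + v + ∑ i ∈ Ico (k + 1) n, d i ≤ ∑ i ∈ Ico a n, x i →
      v * ∏ i ∈ Ico (k + 1) n, d i ≤ ∏ i ∈ Ico a n, x i := by
  intro N
  induction N with
  | zero => intro a k v h₀ h₁ h₂; omega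
  | succ N ih =>
    intro a k v hN hak hkn hv1 hvd hsum
    rw [sum_eq_sum_Ico_succ_bot (by omega : a < n)] at hsum
    rw [prod_eq_prod_Ico_succ_bot (by omega : a < n)]
    obtain ⟨hxa1, hxad⟩ := hx a (by omega)
    have hpos : 1 ≤ ∏ i ∈ Ico (a + 1) n, x i :=
      Finset.one_le_prod' fun i hi => (hx i (mem_Ico.1 hi).2).1
    rcases le_or_gt v (x a) with hva | hva
    · rcases Nat.lt_or_ge (k + 1) n with hk1 | hk1
      · rw [sum_eq_sum_Ico_succ_bot hk1] at hsum
        rw [prod_eq_prod_Ico_succ_bot hk1]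
        have had : d a ≤ d (k + 1) := hd a (k + 1) (by omega) hk1
        -- Replace `(v, d (k + 1))` by `(x a, v + d (k + 1) - x a)`: the sum is the same and, as `v
        -- ≤ x a ≤ d (k + 1)`, the product does not decrease.
        have := ih (a + 1) (k + 1) (v + d (k + 1) - x a) (by omega) (by omega) hk1 (by omega)
          (by omega) (by omega)
        calc v * (d (k + 1) * ∏ i ∈ Ico (k + 1 + 1) n, d i)
            ≤ x a * (v + d (k + 1) - x a) * ∏ i ∈ Ico (k + 1 + 1) n, d i := by
              rw [← mul_assoc]
              refine Nat.mul_le_mul_right _ ?_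
              obtain ⟨b, hb⟩ := Nat.exists_eq_add_of_le hva
              obtain ⟨c, hc⟩ := Nat.exists_eq_add_of_le (hxad.trans had)
              have : v + d (k + 1) - x a = v + c := by omega
              rw [this, hc, hb]
              nlinarith [Nat.zero_le (b * c)]
          _ ≤ _ := by rw [mul_assoc]; exact Nat.mul_le_mul_left _ this
      · rw [Ico_eq_empty (by omega), prod_empty, mul_one]
        exact hva.trans (Nat.le_mul_of_pos_right _ hpos)
    · rcases Nat.eq_or_lt_of_le hak with rfl | hak
      · exfalso
        have h : ∑ i ∈ Ico (a + 1) n, x i ≤ ∑ i ∈ Ico (a + 1) n, d i :=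
          sum_le_sum fun i hi => (hx i (mem_Ico.1 hi).2).2
        omega
      -- Here the extremal entry at `a` is `1`. Raising it to `x a` at the expense of `v` keeps the
      -- sum, and the product of the two does not fall below `1 * v`.
      · have := ih (a + 1) k (v - (x a - 1)) (by omega) (by omega) hkn (by omega)
          (by omega) (by omega)
        calc v * ∏ i ∈ Ico (k + 1) n, d i
            ≤ x a * (v - (x a - 1)) * ∏ i ∈ Ico (k + 1) n, d i := by
              refine Nat.mul_le_mul_right _ ?_
              obtain ⟨b, hb⟩ := Nat.exists_eq_add_of_le hxa1
              obtain ⟨c, hc⟩ := Nat.exists_eq_add_of_le hva.le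
              have : v - (x a - 1) = c + 1 := by omega
              rw [this, hc, hb]
              nlinarith [Nat.zero_le (b * c)]
          _ ≤ _ := by rw [mul_assoc]; exact Nat.mul_le_mul_left _ this

/-! ### Polynomials attaining the bound. -/

open Finset MvPolynomial in
/-- For `x i ≤ #(K i)` there is a polynomial, of degree at most `#(K i) - x i` in each variable and
of total degree at most the sum of these numbers, with exactly `∏ x i` nonzeros on the grid. -/
theorem exists_card_eval_ne_zero_eq_prod {F : Type*} [Field F] [DecidableEq F] {n : ℕ}
    (K : Fin n → Finset F) (x : Fin n → ℕ) (hx : ∀ i, x i ≤ #(K i)) :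
    ∃ f : MvPolynomial (Fin n) F, f.totalDegree ≤ ∑ i, (#(K i) - x i) ∧
      (∀ i, f.degreeOf i ≤ #(K i) - x i) ∧
      #{a ∈ Fintype.piFinset K | eval a f ≠ 0} = ∏ i, x i := by
  choose T hTK hT using fun i => exists_subset_card_eq (Nat.sub_le #(K i) (x i))
  refine ⟨∏ i, ∏ c ∈ T i, (X i - C c), ?_, fun j => ?_, ?_⟩
  · refine (totalDegree_finsetProd _ _).trans (sum_le_sum fun i _ => ?_)
    refine (totalDegree_finsetProd _ _).trans ?_
    rw [← hT i, card_eq_sum_ones]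
    refine sum_le_sum fun c _ => (totalDegree_sub_C_le _ _).trans (totalDegree_X i).le
  · refine (degreeOf_prod_le _ _ _).trans ?_
    have hle (i : Fin n) (c : F) :
        degreeOf j (X i - C c : MvPolynomial (Fin n) F) ≤ if j = i then 1 else 0 := by
      refine (degreeOf_sub_le _ _ _).trans ?_
      rw [degreeOf_C, degreeOf_X]; simp
    calc _ ≤ ∑ i, ∑ c ∈ T i, (if j = i then 1 else 0) :=
          sum_le_sum fun i _ => (degreeOf_prod_le _ _ _).trans (sum_le_sum fun c _ => hle i c)
      _ = _ := by simp [hT]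
  · have : {a ∈ Fintype.piFinset K | eval a (∏ i, ∏ c ∈ T i, (X i - C c)) ≠ 0} =
        Fintype.piFinset fun i => K i \ T i := by
      ext a
      simp only [mem_filter, Fintype.mem_piFinset, map_prod, ne_eq, prod_eq_zero_iff, mem_univ,
        true_and, map_sub, eval_X, eval_C, sub_eq_zero, mem_sdiff, not_exists, not_and]
      refine ⟨fun h i => ⟨h.1 i, fun hi => h.2 i _ hi rfl⟩,
        fun h => ⟨fun i => (h i).1, fun i c hc hic => (h i).2 (hic ▸ hc)⟩⟩
    rw [this, Fintype.card_piFinset]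
    refine prod_congr rfl fun i _ => ?_
    rw [card_sdiff_of_subset (hTK i), hT, Nat.sub_sub_self (hx i)]

/-! ### Linear codes and the Singleton-like bound. -/

theorem minDistance_le_hammingNorm {F ι : Type*} [Field F] [DecidableEq F] [Fintype ι]
    {C : Submodule F (ι → F)} {z : ι → F} (hz : z ∈ C) (hz0 : z ≠ 0) :
    minDistance C ≤ hammingNorm z :=
  Nat.sInf_le ⟨z, hz, 0, C.zero_mem, hz0, hammingDist_zero_right z⟩

theorem exists_hammingNorm_eq_minDistance {F ι : Type*} [Field F] [DecidableEq F] [Fintype ι]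
    {C : Submodule F (ι → F)} (hC : C ≠ ⊥) :
    ∃ z ∈ C, z ≠ 0 ∧ hammingNorm z = minDistance C := by
  obtain ⟨z, hz, hz0⟩ := C.ne_bot_iff.1 hC
  obtain ⟨x, hx, y, hy, hxy, h⟩ := Nat.sInf_mem
    (s := {w : ℕ | ∃ x ∈ C, ∃ y ∈ C, x ≠ y ∧ hammingDist x y = w})
    ⟨_, z, hz, 0, C.zero_mem, hz0, rfl⟩
  refine ⟨x - y, C.sub_mem hx hy, sub_ne_zero.2 hxy, ?_⟩
  rw [minDistance, ← h, hammingDist_comm, hammingDist_eq_hammingNorm, neg_add_eq_sub]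

open Finset in
/-- A linear code has a nonzero word vanishing on any prescribed set of fewer coordinates than its
dimension. -/
theorem exists_mem_ne_zero_forall_eq_zero {F ι : Type*} [Field F] [Fintype ι]
    (C : Submodule F (ι → F)) (P : Finset ι) (hP : #P < Module.finrank F C) :
    ∃ z ∈ C, z ≠ 0 ∧ ∀ i ∈ P, z i = 0 := by
  let L : C →ₗ[F] (P → F) := (LinearMap.funLeft F F (Subtype.val : P → ι)).comp C.subtype
  have hker : LinearMap.ker L ≠ ⊥ := fun h => by
    have := LinearMap.finrank_le_finrank_of_injective (LinearMap.ker_eq_bot.1 h)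
    rw [Module.finrank_fintype_fun_eq_card, Fintype.card_coe] at this
    omega
  obtain ⟨z, hz, hz0⟩ := (LinearMap.ker L).ne_bot_iff.1 hker
  refine ⟨z, z.2, fun h => hz0 (Subtype.ext h), fun i hi => ?_⟩
  exact congrFun (LinearMap.mem_ker.1 hz) ⟨i, hi⟩

open Finset in
/-- **Singleton-like bound for locally recoverable codes**, for repair groups that are the fibres
of a map `π`: if all fibres have `N` elements and a word vanishing on `r` points of a fibre vanishes
on the whole fibre, then some nonzero word has at least `κ - 1 + ((κ - 1) / r) * (N - r)` zeros,
where `κ` is the dimension. -/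
theorem exists_hammingNorm_add_le_card {F ι : Type*} [Field F] [DecidableEq F] [Fintype ι]
    [DecidableEq ι] (C : Submodule F (ι → F)) (π : ι → ι) {N r : ℕ} (hr : 0 < r) (hrN : r ≤ N)
    (hfib : ∀ a, #{b | π b = π a} = N)
    (hloc : ∀ z ∈ C, ∀ a, r ≤ #{b | π b = π a ∧ z b = 0} → z a = 0)
    (hC : 0 < Module.finrank F C) :
    ∃ z ∈ C, z ≠ 0 ∧ hammingNorm z + (Module.finrank F C - 1) +
      ((Module.finrank F C - 1) / r) * (N - r) ≤ Fintype.card ι := by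
  set κ := Module.finrank F C with hκ
  set t := (κ - 1) / r with ht
  set Γ : Finset ι := univ.image π with hΓ
  have hT : ∀ g : ι, ∃ T : Finset ι, g ∈ Γ → T ⊆ ({b | π b = g} : Finset ι) ∧ #T = r := by
    intro g
    by_cases hg : g ∈ Γ
    · obtain ⟨a, -, rfl⟩ := mem_image.1 hg
      obtain ⟨T, h⟩ := exists_subset_card_eq (hrN.trans (hfib a).ge)
      exact ⟨T, fun _ => h⟩
    · exact ⟨∅, fun h => absurd h hg⟩
  choose T hT using hT
  have hdisj {A : Finset ι} (hA : A ⊆ Γ) :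
      (A : Set ι).PairwiseDisjoint T := fun g hg g' hg' hne => by
    refine disjoint_left.2 fun b hb hb' => hne ?_
    rw [← (mem_filter.1 ((hT g (hA hg)).1 hb)).2, (mem_filter.1 ((hT g' (hA hg')).1 hb')).2]
  have hcardT {A : Finset ι} (hA : A ⊆ Γ) : #(A.biUnion T) = #A * r := by
    rw [card_biUnion (hdisj hA), sum_congr rfl fun g hg => (hT g (hA hg)).2, sum_const,
      smul_eq_mul]
  have hspread {A : Finset ι} (hA : A ⊆ Γ) {z : ι → F} (hz : z ∈ C)
      (hzero : ∀ b ∈ A.biUnion T, z b = 0) (a : ι) (ha : π a ∈ A) : z a = 0 := by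
    refine hloc z hz a ?_
    rw [← (hT (π a) (hA ha)).2]
    refine card_le_card fun b hb => ?_
    exact mem_filter.2 ⟨mem_univ _, (mem_filter.1 ((hT _ (hA ha)).1 hb)).2,
      hzero b (mem_biUnion.2 ⟨_, ha, hb⟩)⟩
  have htr : t * r ≤ κ - 1 := Nat.div_mul_le_self _ _
  have htr' : κ - 1 - t * r < r := by
    have h1 := Nat.div_add_mod (κ - 1) r
    have h2 := Nat.mod_lt (κ - 1) hr
    rw [← ht, mul_comm] at h1
    omega
  -- Otherwise vanishing on `r` points of every fibre would be fewer than `κ` conditions, yet would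
  -- force the zero word. So a fibre remains for the leftover conditions.
  have htΓ : t < #Γ := by
    by_contra! hcon
    have hlt : #(Γ.biUnion T) < κ := by
      rw [hcardT subset_rfl]
      have := Nat.mul_le_mul_right r hcon
      omega
    obtain ⟨z, hz, hz0, hzero⟩ := exists_mem_ne_zero_forall_eq_zero C _ hlt
    exact hz0 (funext fun a =>
      hspread subset_rfl hz hzero a (mem_image_of_mem _ (mem_univ _)))
  obtain ⟨A, hAΓ, hAt⟩ := exists_subset_card_eq htΓ.le
  obtain ⟨g₀, hg₀, hg₀A⟩ := exists_mem_notMem_of_card_lt_card (hAt.trans_lt htΓ)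
  obtain ⟨T₀, hT₀, hT₀card⟩ := exists_subset_card_eq (htr'.le.trans (hT g₀ hg₀).2.ge)
  have hT₀π {b : ι} (hb : b ∈ T₀) : π b = g₀ := (mem_filter.1 ((hT g₀ hg₀).1 (hT₀ hb))).2
  have hP : #(A.biUnion T ∪ T₀) < κ := by
    refine (card_union_le _ _).trans_lt ?_
    rw [hcardT hAΓ, hT₀card, hAt]
    omega
  obtain ⟨z, hz, hz0, hzero⟩ := exists_mem_ne_zero_forall_eq_zero C _ hP
  refine ⟨z, hz, hz0, ?_⟩
  have hcardA : #{b | π b ∈ A} = t * N := by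
    rw [card_eq_sum_card_fiberwise (f := π) (t := A)
      (fun b hb => mem_coe.2 (mem_filter.1 (mem_coe.1 hb)).2), ← hAt]
    refine sum_const_nat fun g hg => ?_
    obtain ⟨a, -, rfl⟩ := mem_image.1 (hAΓ hg)
    rw [← hfib a, filter_filter]
    congr 1
    ext b
    simp only [mem_filter, mem_univ, true_and]
    exact ⟨fun h => h.2, fun h => ⟨h ▸ hg, h⟩⟩
  -- The `κ - 1` imposed zeros grow to this many, since each of the `t` chosen fibres is completed
  -- from `r` to `N` zeros.
  have hQ : #(({b | π b ∈ A} : Finset ι) ∪ T₀) = t * N + (κ - 1 - t * r) := by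
    rw [card_union_of_disjoint, hT₀card, hcardA]
    refine disjoint_left.2 fun b hb hb' => hg₀A ?_
    rw [← hT₀π hb']
    exact (mem_filter.1 hb).2
  have hsub : ({b | π b ∈ A} : Finset ι) ∪ T₀ ⊆ ({b | ¬ z b ≠ 0} : Finset ι) := by
    intro b hb
    simp only [mem_filter, mem_univ, true_and, not_not]
    rcases mem_union.1 hb with hb | hb
    · exact hspread hAΓ hz (fun b hb => hzero b (mem_union_left _ hb)) b (mem_filter.1 hb).2
    · exact hzero b (mem_union_right _ hb)
  have hcard := card_le_card hsub
  have htot := card_filter_add_card_filter_not (s := (univ : Finset ι)) (fun b => z b ≠ 0)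
  rw [hQ] at hcard
  rw [card_univ] at htot
  have hnorm : hammingNorm z = #{b | z b ≠ 0} := rfl
  have hmul : t * N = t * r + t * (N - r) := by rw [← mul_add, Nat.add_sub_cancel' hrN]
  omega

/-! ### Restriction to lines and weights of evaluation words. -/

open MvPolynomial in
/-- The restriction of a multivariate polynomial to a line in the direction of the variable `s` is
a univariate polynomial of degree at most the degree in that variable. -/
theorem exists_natDegree_le_degreeOf_eval_update {F σ : Type*} [Field F] [Fintype σ]
    [DecidableEq σ] (f : MvPolynomial σ F) (s : σ) (a : σ → F) :
    ∃ p : Polynomial F, p.natDegree ≤ f.degreeOf s ∧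
      ∀ c, p.eval c = eval (Function.update a s c) f := by
  set φ : σ → Polynomial F := Function.update (fun i => Polynomial.C (a i)) s Polynomial.X with hφ
  refine ⟨aeval φ f, ?_, fun c => ?_⟩
  · rw [aeval_def, eval₂_eq']
    refine Polynomial.natDegree_sum_le_of_forall_le _ _ fun m hm => ?_
    refine (Polynomial.natDegree_C_mul_le _ _).trans ?_
    refine (Polynomial.natDegree_prod_le _ _).trans ?_
    refine le_trans ?_ (monomial_le_degreeOf s hm)
    calc ∑ i, (φ i ^ m i).natDegree ≤ ∑ i, if i = s then m i else 0 := by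
          refine Finset.sum_le_sum fun i _ => ?_
          split_ifs with h
          · subst h
            simp [hφ]
          · simp [hφ, Function.update_of_ne h]
      _ = m s := by simp
  · rw [← Polynomial.coe_evalRingHom, aeval_def, ← MvPolynomial.coe_eval₂Hom,
      ← RingHom.comp_apply]
    refine DFunLike.congr_fun (MvPolynomial.ringHom_ext (fun r => by simp) fun i => ?_) f
    by_cases h : i = s
    · subst h; simp [hφ]
    · simp [hφ, Function.update_of_ne h]

open Finset in
theorem hammingNorm_evalPoints {F : Type*} [Field F] [DecidableEq F] {n : ℕ}
    (K : Fin n → Finset F) (f : MvPolynomial (Fin n) F) :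
    hammingNorm (evalPoints K f) =
      #{a ∈ Fintype.piFinset K | MvPolynomial.eval a f ≠ 0} := by
  rw [hammingNorm, ← card_map (Function.Embedding.subtype _)]
  congr 1
  ext a
  simp only [mem_map, mem_filter, mem_univ, true_and]
  constructor
  · rintro ⟨b, hb, rfl⟩
    exact ⟨b.2, by simpa [evalPoints, MvPolynomial.aeval_eq_eval] using hb⟩
  · rintro ⟨ha, h⟩
    exact ⟨⟨a, ha⟩, by simpa [evalPoints, MvPolynomial.aeval_eq_eval] using h, rfl⟩

/-! ### Greedy weights and the lower bound for affine cartesian codes. -/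

/-- The weights, for budget `∑ i < k, (c i - 1) + l`, obtained from `c` by decreasing its entries
to `1` as far as the budget allows, starting with the smallest indices. -/
def greedyWeights {n : ℕ} (c : Fin n → ℕ) (k : Fin n) (l : ℕ) (i : Fin n) : ℕ :=
  if i < k then 1 else if i = k then c k - l else c i

theorem greedyWeights_mem_Icc {n : ℕ} {c : Fin n → ℕ} {k : Fin n} {l : ℕ} (hc : ∀ i, 1 ≤ c i)
    (hl : l ≤ c k - 1) (i : Fin n) : 1 ≤ greedyWeights c k l i ∧ greedyWeights c k l i ≤ c i := by
  have := hc i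
  have := hc k
  unfold greedyWeights
  split_ifs with h1 h2
  · omega
  · subst h2; omega
  · omega

theorem sum_sub_greedyWeights {n : ℕ} {c : Fin n → ℕ} {k : Fin n} {l : ℕ} (hc : ∀ i, 1 ≤ c i)
    (hl : l ≤ c k - 1) :
    ∑ i, (c i - greedyWeights c k l i) = (∑ i : Fin n with i.val < k.val, (c i - 1)) + l := by
  have h (i : Fin n) : c i - greedyWeights c k l i =
      (if i.val < k.val then c i - 1 else 0) + (if i = k then l else 0) := by
    have := hc k
    simp only [greedyWeights, ← Fin.lt_def]
    split_ifs with h1 h2 h2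
    · exact absurd h1 (h2 ▸ lt_irrefl _)
    · omega
    · subst h2; omega
    · omega
  rw [Finset.sum_congr rfl fun i _ => h i, Finset.sum_add_distrib, ← Finset.sum_filter]
  simp

open Finset in
theorem prod_greedyWeights_le {n : ℕ} {c x : Fin n → ℕ} {k : Fin n} {l : ℕ} (hc : Monotone c)
    (hx : ∀ i, 1 ≤ x i ∧ x i ≤ c i) (hl : l ≤ c k - 1)
    (hsum : ∑ i, greedyWeights c k l i ≤ ∑ i, x i) :
    ∏ i, greedyWeights c k l i ≤ ∏ i, x i := by
  -- The value `0` beyond `n` is never used: all intervals below stay under `n`.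
  let ext (f : Fin n → ℕ) (i : ℕ) : ℕ := if h : i < n then f ⟨i, h⟩ else 0
  have ext_val (f : Fin n → ℕ) (i : Fin n) : ext f i = f i := by simp [ext]
  have hS (f : Fin n → ℕ) : ∑ i, f i = ∑ i ∈ Ico 0 n, ext f i := by
    rw [← range_eq_Ico, ← Fin.sum_univ_eq_sum_range]
    exact sum_congr rfl fun i _ => (ext_val f i).symm
  have hP (f : Fin n → ℕ) : ∏ i, f i = ∏ i ∈ Ico 0 n, ext f i := by
    rw [← range_eq_Ico, ← Fin.prod_univ_eq_prod_range]
    exact prod_congr rfl fun i _ => (ext_val f i).symm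
  have hck := (hx k).1.trans (hx k).2
  have g_lt : ∀ i ∈ Ico 0 k.val, ext (greedyWeights c k l) i = 1 := fun i hi => by
    have hi' := (mem_Ico.1 hi).2
    have : i < n := hi'.trans k.2
    simp [ext, this, greedyWeights, Fin.lt_def, hi']
  have g_eq : ext (greedyWeights c k l) k = c k - l := by simp [ext, greedyWeights]
  have g_gt : ∀ i ∈ Ico (k.val + 1) n, ext (greedyWeights c k l) i = ext c i := fun i hi => by
    obtain ⟨h1, h2⟩ := mem_Ico.1 hi
    have h3 : ¬ i < k.val := by omega
    have h4 : i ≠ k.val := by omega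
    simp [ext, h2, greedyWeights, Fin.lt_def, h3, Fin.ext_iff, h4]
  rw [hS, hS, ← sum_Ico_consecutive _ (Nat.zero_le _) k.2.le, sum_eq_sum_Ico_succ_bot k.2,
    sum_congr rfl g_lt, g_eq, sum_congr rfl g_gt] at hsum
  rw [hP, hP, ← prod_Ico_consecutive _ (Nat.zero_le _) k.2.le, prod_eq_prod_Ico_succ_bot k.2,
    prod_congr rfl g_lt, g_eq, prod_congr rfl g_gt, prod_const_one, one_mul]
  refine mul_prod_Ico_le_prod_Ico (d := ext c) (x := ext x) ?_ ?_ n 0 k _ (by omega)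
    (Nat.zero_le _) k.2 (by omega) (by rw [ext_val]; omega) ?_
  · intro i j hij hj
    simp only [ext, hj, hij.trans_lt hj, dite_true]
    exact hc hij
  · intro i hi
    simp only [ext, hi, dite_true]
    exact hx _
  · simpa [add_assoc] using hsum

/-- The word is also given by a reduced polynomial of no larger degree. Its nonzero count is at
least some `∏ x i` with total deficit at most that degree, and the greedy weights spend exactly this
budget while minimising the product. -/
theorem prod_greedyWeights_le_hammingNorm {F : Type*} [Field F] [DecidableEq F] {n : ℕ}
    {K : Fin n → Finset F} (hK : ∀ i, (K i).Nonempty) (hmono : Monotone fun i => (K i).card)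
    {k : Fin n} {l : ℕ} (hl : l ≤ (K k).card - 1) {z : ↥(Fintype.piFinset K) → F}
    (hz : z ∈ affineCartesianCode K
      ((∑ i : Fin n with i.val < k.val, ((K i).card - 1)) + l)) (hz0 : z ≠ 0) :
    ∏ i, greedyWeights (fun i => (K i).card) k l i ≤ hammingNorm z := by
  obtain ⟨f, hf, rfl⟩ := hz
  have hf : f.totalDegree ≤ _ := (MvPolynomial.mem_restrictTotalDegree _ _ _).1 hf
  have hc (i : Fin n) : 1 ≤ (K i).card := (hK i).card_pos
  obtain ⟨g, hgf, hgK, hg⟩ := exists_degreeOf_lt_card_eval_eq K hK f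
  have hgz : evalPoints K g = evalPoints K f := funext fun a => by
    simpa [evalPoints, MvPolynomial.aeval_eq_eval] using hg a (Fintype.mem_piFinset.1 a.2)
  rw [← hgz] at hz0 ⊢
  obtain ⟨x, hx, hsum, hprod⟩ := exists_prod_le_card_eval_ne_zero_of_degreeOf_lt K g
    (fun h => hz0 (by rw [h, map_zero])) hgK
  rw [hammingNorm_evalPoints]
  refine (prod_greedyWeights_le hmono hx hl ?_).trans hprod
  have h1 := sum_sub_greedyWeights (c := fun i => (K i).card) hc hl
  have h2 : ∑ i, (K i).card = ∑ i, ((K i).card - greedyWeights (fun i => (K i).card) k l i) +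
      ∑ i, greedyWeights (fun i => (K i).card) k l i := by
    rw [← Finset.sum_add_distrib]
    exact Finset.sum_congr rfl fun i _ =>
      (Nat.sub_add_cancel (greedyWeights_mem_Icc (c := fun i => (K i).card) hc hl i).2).symm
  omega

/-! ### Upper bounds for quasi affine cartesian codes. -/

theorem quasiAffineCartesianCode_le {F : Type*} [Field F] {n : ℕ} (K : Fin n → Finset F)
    (δ : ℕ) (s : Fin n) (d : ℕ) : quasiAffineCartesianCode K δ s d ≤ affineCartesianCode K d :=
  Submodule.map_mono fun _ hf => (MvPolynomial.mem_restrictTotalDegree _ _ _).2 hf.1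

theorem quasiAffineCartesianCode_ne_bot {F : Type*} [Field F] {n : ℕ} {K : Fin n → Finset F}
    (hK : ∀ i, (K i).Nonempty) {δ : ℕ} {s : Fin n} (hδ : δ ≤ (K s).card) (d : ℕ) :
    quasiAffineCartesianCode K δ s d ≠ ⊥ := by
  refine (Submodule.ne_bot_iff _).2 ⟨evalPoints K 1, ⟨1, ⟨by simp, Or.inr ?_⟩, rfl⟩, fun h => ?_⟩
  · rw [← MvPolynomial.C_1, MvPolynomial.degreeOf_C]; omega
  · choose a ha using hK
    have := congrFun h ⟨a, Fintype.mem_piFinset.2 ha⟩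
    simp [evalPoints] at this

/-- If exchanging the entries of `greedyWeights` at `s` and `t` keeps them bounded by the sizes
`#(K i)`, and the new entry at `s` exceeds `#(K s) - r`, where `r = #(K s) - δ + 1`, then the
product of the entries bounds the minimum distance of the quasi affine cartesian code. -/
theorem minDistance_quasiAffineCartesianCode_le {F : Type*} [Field F] [DecidableEq F] {n : ℕ}
    {K : Fin n → Finset F} (hK : ∀ i, (K i).Nonempty) {k s : Fin n} {l δ : ℕ}
    (hδ : δ ≤ (K s).card) (hl : l ≤ (K k).card - 1) (t : Fin n)
    (hs : greedyWeights (fun i => (K i).card) k l t ≤ (K s).card)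
    (ht : greedyWeights (fun i => (K i).card) k l s ≤ (K t).card)
    (hr : (K s).card < greedyWeights (fun i => (K i).card) k l t + ((K s).card - δ + 1)) :
    minDistance (quasiAffineCartesianCode K δ s
        ((∑ i : Fin n with i.val < k.val, ((K i).card - 1)) + l)) ≤
      ∏ i, greedyWeights (fun i => (K i).card) k l i := by
  set c : Fin n → ℕ := fun i => (K i).card
  have hc (i : Fin n) : 1 ≤ c i := (hK i).card_pos
  -- The swap preserves both sum and product, hence the degree budget and the weight. Only the
  -- degree in `X_s`, at most `c s - x s`, changes to advantage.
  set x : Fin n → ℕ := fun i => greedyWeights c k l (Equiv.swap s t i) with hx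
  have hxs : x s = greedyWeights c k l t := by simp [hx]
  have hxc (i : Fin n) : 1 ≤ x i ∧ x i ≤ c i := by
    refine ⟨(greedyWeights_mem_Icc hc hl _).1, ?_⟩
    by_cases his : i = s
    · rw [his, hxs]; exact hs
    by_cases hit : i = t
    · simp only [hx, hit, Equiv.swap_apply_right]; exact ht
    · simp only [hx, Equiv.swap_apply_of_ne_of_ne his hit]
      exact (greedyWeights_mem_Icc hc hl _).2
  have hprod : ∏ i, x i = ∏ i, greedyWeights c k l i :=
    Equiv.prod_comp (Equiv.swap s t) (greedyWeights c k l)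
  have hsum : ∑ i, x i = ∑ i, greedyWeights c k l i :=
    Equiv.sum_comp (Equiv.swap s t) (greedyWeights c k l)
  have hsub {y : Fin n → ℕ} (hy : ∀ i, y i ≤ c i) : ∑ i, (c i - y i) + ∑ i, y i = ∑ i, c i := by
    rw [← Finset.sum_add_distrib]
    exact Finset.sum_congr rfl fun i _ => Nat.sub_add_cancel (hy i)
  obtain ⟨f, hfd, hfs, hf⟩ := exists_card_eval_ne_zero_eq_prod K x fun i => (hxc i).2
  rw [← hprod, ← hf, ← hammingNorm_evalPoints]
  refine minDistance_le_hammingNorm ⟨f, ⟨?_, Or.inr ?_⟩, rfl⟩ fun h => ?_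
  · rw [← sum_sub_greedyWeights hc hl]
    have h1 := hsub fun i => (hxc i).2
    have h2 := hsub fun i => (greedyWeights_mem_Icc hc hl i).2
    have h3 : f.totalDegree ≤ ∑ i, (c i - x i) := hfd
    omega
  · have h1 := hfs s
    rw [hxs] at h1
    omega
  · rw [← hammingNorm_eq_zero, hammingNorm_evalPoints, hf, Finset.prod_eq_zero_iff] at h
    obtain ⟨i, -, hi⟩ := h
    have := (hxc i).1
    omega

open Finset in
/-- The quasi affine cartesian code satisfies the Singleton-like bound for locally recoverable
codes, the repair groups being the lines in the direction of `s`. -/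
theorem minDistance_quasiAffineCartesianCode_add_le {F : Type*} [Field F] [DecidableEq F] {n : ℕ}
    {K : Fin n → Finset F} (hK : ∀ i, (K i).Nonempty) {s : Fin n} {δ : ℕ} (hδ1 : 1 ≤ δ)
    (hδ : δ ≤ #(K s)) (d : ℕ) :
    minDistance (quasiAffineCartesianCode K δ s d) +
        (Module.finrank F (quasiAffineCartesianCode K δ s d) - 1) +
        ((Module.finrank F (quasiAffineCartesianCode K δ s d) - 1) / (#(K s) - δ + 1)) * (δ - 1) ≤
      ∏ i, #(K i) := by
  obtain ⟨c₀, hc₀⟩ := hK s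
  have hupd {a : Fin n → F} (ha : a ∈ Fintype.piFinset K) {c : F} (hc : c ∈ K s) :
      Function.update a s c ∈ Fintype.piFinset K := by
    rw [Fintype.mem_piFinset] at ha ⊢
    intro i
    by_cases h : i = s
    · subst h; simpa using hc
    · simpa [h] using ha i
  -- Resetting coordinate `s` to `c₀` makes the fibres exactly the grid lines in direction `s`.
  let π : ↥(Fintype.piFinset K) → ↥(Fintype.piFinset K) :=
    fun a => ⟨Function.update a s c₀, hupd a.2 hc₀⟩
  have hπ {a b : ↥(Fintype.piFinset K)} (h : π b = π a) :
      Function.update a.1 s (b.1 s) = b.1 := by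
    have := congrArg (fun e => Function.update e.1 s (b.1 s)) h
    simpa [π] using this.symm
  have hinj (a : ↥(Fintype.piFinset K)) (b b' : ↥(Fintype.piFinset K)) (hb : π b = π a)
      (hb' : π b' = π a) (h : b.1 s = b'.1 s) : b = b' := by
    apply Subtype.ext
    rw [← hπ hb, ← hπ hb', h]
  have hfib (a : ↥(Fintype.piFinset K)) : #{b | π b = π a} = #(K s) := by
    refine card_bij (fun b _ => b.1 s) (fun b _ => Fintype.mem_piFinset.1 b.2 s)
      (fun b hb b' hb' h => hinj a b b' (mem_filter.1 hb).2 (mem_filter.1 hb').2 h)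
      fun c hc => ⟨⟨Function.update a.1 s c, hupd a.2 hc⟩, ?_, by simp⟩
    simp [π]
  have hloc : ∀ z ∈ quasiAffineCartesianCode K δ s d, ∀ a,
      #(K s) - δ + 1 ≤ #{b | π b = π a ∧ z b = 0} → z a = 0 := by
    rintro z ⟨f, ⟨-, hf⟩, rfl⟩ a ha
    rcases hf with rfl | hf
    · simp
    obtain ⟨p, hp, hpe⟩ := exists_natDegree_le_degreeOf_eval_update f s a.1
    have heval (b : ↥(Fintype.piFinset K)) (hb : π b = π a) :
        p.eval (b.1 s) = evalPoints K f b := by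
      rw [hpe, hπ hb]
      simp [evalPoints, MvPolynomial.aeval_eq_eval]
    set B : Finset ↥(Fintype.piFinset K) := {b | π b = π a ∧ evalPoints K f b = 0} with hB
    have hBcard : #(B.image fun b => b.1 s) = #B := card_image_of_injOn fun b hb b' hb' h =>
      hinj a b b' (mem_filter.1 (mem_coe.1 hb)).2.1 (mem_filter.1 (mem_coe.1 hb')).2.1 h
    have hp0 : p = 0 := by
      refine Polynomial.eq_zero_of_natDegree_lt_card_of_eval_eq_zero' p (B.image fun b => b.1 s)
        ?_ (by rw [hBcard]; omega)
      intro c hc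
      obtain ⟨b, hb, rfl⟩ := mem_image.1 hc
      have hb' := (mem_filter.1 hb).2
      rw [heval b hb'.1, hb'.2]
    rw [← heval a rfl, hp0, Polynomial.eval_zero]
  obtain ⟨z, hz, hz0, h⟩ := exists_hammingNorm_add_le_card (quasiAffineCartesianCode K δ s d) π
    (by omega) (by omega) hfib hloc (Module.finrank_pos_iff.2
      (Submodule.nontrivial_iff_ne_bot.2 (quasiAffineCartesianCode_ne_bot hK hδ d)))
  rw [Fintype.card_coe, Fintype.card_piFinset] at h
  have h' := minDistance_le_hammingNorm hz hz0
  have : #(K s) - (#(K s) - δ + 1) = δ - 1 := by omega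
  rw [this] at h
  omega

/-! ### Assembling the theorem. -/

/-- Identifies the ceiling term of the bound with the number of completely vanishing lines. -/
theorem ceil_div_natCast_sub_one {a b : ℕ} (ha : 0 < a) (hb : 0 < b) :
    ⌈(a : ℝ) / (b : ℝ)⌉ - 1 = (((a - 1) / b : ℕ) : ℤ) := by
  rw [sub_eq_iff_eq_add, Int.ceil_eq_iff]
  have hb' : (0 : ℝ) < b := by exact_mod_cast hb
  have h1 := Nat.div_add_mod (a - 1) b
  have h2 := Nat.mod_lt (a - 1) hb
  push_cast
  rw [lt_div_iff₀ hb', div_le_iff₀ hb', add_sub_cancel_right]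
  constructor
  · have : (a - 1) / b * b < a := by rw [mul_comm]; omega
    exact_mod_cast this
  · have : a ≤ ((a - 1) / b + 1) * b := by rw [add_mul, mul_comm]; omega
    exact_mod_cast this

theorem theorem4p1 {F : Type*} [Field F] [Finite F] [DecidableEq F] {n : ℕ}
    (K : Fin n → Finset F) (hK : ∀ i, (K i).Nonempty)
    (hmono : ∀ i j : Fin n, i ≤ j → (K i).card ≤ (K j).card)
    (s : Fin n) (δ r : ℕ) (hδ : 2 ≤ δ) (hδs : δ ≤ (K s).card) (hr : r = (K s).card - δ + 1)
    (d k l m κ : ℕ) (hk : k < n) (hl0 : 0 < l) (hl : l ≤ (K ⟨k, hk⟩).card - 1)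
    (hd : d = (∑ i : Fin n with i.val < k, ((K i).card - 1)) + l)
    (hm : m = ∏ i : Fin n, (K i).card)
    (hκ : κ = Module.finrank F (quasiAffineCartesianCode K δ s d)) :
    (minDistance (affineCartesianCode K d) ≤ minDistance (quasiAffineCartesianCode K δ s d) ∧
      (minDistance (quasiAffineCartesianCode K δ s d) : ℤ) ≤
        (m : ℤ) - κ - (⌈(κ : ℝ) / (r : ℝ)⌉ - 1) * ((δ : ℤ) - 1) + 1) ∧
    (((∃ hk2 : k + 1 < n, (K ⟨k + 1, hk2⟩).card ≤ (K s).card) ∨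
        ((K s).card ≤ (K ⟨k, hk⟩).card ∧
          0 ≤ ((K s).card : ℤ) - (((K ⟨k, hk⟩).card : ℤ) - l) ∧
          ((K s).card : ℤ) - (((K ⟨k, hk⟩).card : ℤ) - l) < r)) →
      minDistance (quasiAffineCartesianCode K δ s d) =
        minDistance (affineCartesianCode K d)) := by
  have hbot := quasiAffineCartesianCode_ne_bot hK hδs d
  have hle := quasiAffineCartesianCode_le K δ s d
  have hfst : minDistance (affineCartesianCode K d) ≤
      minDistance (quasiAffineCartesianCode K δ s d) := by
    obtain ⟨z, hz, hz0, h⟩ := exists_hammingNorm_eq_minDistance hbot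
    rw [← h]
    exact minDistance_le_hammingNorm (hle hz) hz0
  refine ⟨⟨hfst, ?_⟩, fun hcase => le_antisymm ?_ hfst⟩
  · have h := minDistance_quasiAffineCartesianCode_add_le hK (by omega) hδs d
    have hκ0 : 0 < κ := hκ ▸ Module.finrank_pos_iff.2 (Submodule.nontrivial_iff_ne_bot.2 hbot)
    rw [← hκ, ← hr, ← hm] at h
    rw [ceil_div_natCast_sub_one hκ0 (by omega)]
    have hδ' : ((δ : ℤ) - 1) = ((δ - 1 : ℕ) : ℤ) := by omega
    rw [hδ', ← Nat.cast_mul]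
    omega
  · have hlower : ∏ i, greedyWeights (fun i => (K i).card) ⟨k, hk⟩ l i ≤
        minDistance (affineCartesianCode K d) := by
      obtain ⟨z, hz, hz0, h⟩ := exists_hammingNorm_eq_minDistance
        (fun h => hbot (le_bot_iff.1 (h ▸ hle)) : affineCartesianCode K d ≠ ⊥)
      rw [← h]
      rw [hd] at hz
      exact prod_greedyWeights_le_hammingNorm hK (fun i j => hmono i j) hl hz hz0
    refine le_trans ?_ hlower
    rw [hd]
    have hle_c := fun i => (greedyWeights_mem_Icc (c := fun i => (K i).card)
      (fun i => (hK i).card_pos) hl i).2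
    have hpos := (hK ⟨k, hk⟩).card_pos
    rcases hcase with ⟨hk2, hks⟩ | ⟨hsk, h0, hsr⟩
    -- If `s` lies beyond `k`, its greedy weight is already full and no swap is needed. Otherwise
    -- monotonicity and (i) give sides `s` and `k + 1` equal size, and swapping them makes the
    -- weight at `s` full.
    · by_cases hsk : k < s.val
      · have hw : greedyWeights (fun i => (K i).card) ⟨k, hk⟩ l s = (K s).card := by
          have h1 : ¬ s < ⟨k, hk⟩ := fun h => by have := Fin.lt_def.1 h; simp at this; omega
          have h2 : s ≠ ⟨k, hk⟩ := fun h => by rw [h] at hsk; simp at hsk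
          simp [greedyWeights, h1, h2]
        exact minDistance_quasiAffineCartesianCode_le hK (k := ⟨k, hk⟩) hδs hl s (hle_c s)
          (hle_c s) (by rw [hw]; omega)
      · have hw : greedyWeights (fun i => (K i).card) ⟨k, hk⟩ l ⟨k + 1, hk2⟩ =
            (K ⟨k + 1, hk2⟩).card := by
          simp [greedyWeights, Fin.lt_def]
        have hsk' := hmono s ⟨k + 1, hk2⟩ (Fin.le_def.2 (by simp; omega))
        exact minDistance_quasiAffineCartesianCode_le hK (k := ⟨k, hk⟩) hδs hl ⟨k + 1, hk2⟩
          (by rw [hw]; exact hks) ((hle_c s).trans hsk') (by rw [hw]; omega)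
    · have hw : greedyWeights (fun i => (K i).card) ⟨k, hk⟩ l ⟨k, hk⟩ =
          (K ⟨k, hk⟩).card - l := by
        simp [greedyWeights]
      -- Moving the partial weight `d_{k+1} - ℓ` to `s` gives degree at most `d_s - (d_{k+1} - ℓ)`
      -- in `X_s`, which (ii) bounds by `r`.
      exact minDistance_quasiAffineCartesianCode_le hK (k := ⟨k, hk⟩) hδs hl ⟨k, hk⟩
        (by rw [hw]; omega) ((hle_c s).trans hsk) (by rw [hw]; omega)
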